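/- There are universal constants $C, c, C' > 0$ such that the following holds. Let $n, \ell, r \ge 1$ be integers with $r \le \frac12 n^{\ell}$, let $\rho > 0$ and $K \in \mathbb{R}$, let $X_i^{(j)} \in \mathbb{R}^n$ ($1 \le i \le r$, $1 \le j \le \ell$) be deterministic vectors with $\|X_i^{(j)}\|_2 \le K$, and let $G_i^{(j)} \sim N\left(0, \frac{\rho^2}{n} \mathbb{I}_n\right)$ ($1 \le i \le r$, $1 \le j \le \ell$) be jointly independent Gaussian random vectors in $\mathbb{R}^n$. Put $\widetilde X_i^{(j)} = X_i^{(j)} + G_i^{(j)}$, and let $A$ be the $n^{\ell} \times r$ matrix whose $i$-th column is the flattened vector of the tensor $\widetilde X_i^{(1)} \otimes \cdots \otimes \widetilde X_i^{(\ell)}$, that is, the vector with entries $\prod_{j=1}^{\ell} \big(\widetilde X_i^{(j)}\big)_{k_j}$, $(k_1, \dots, k_\ell) \in \{1, \dots, n\}^{\ell}$. Let $s_{\min}(A)$ be the smallest (i.e. the $r$-th largest) singular value of $A$. Then for every $0 < \varepsilon < e^{-C\ell}$, $$\mathbb{P}\left(s_{\min}(A) \le \sqrt{1 - \frac{r}{n^{\ell}}}\,(c\rho)^{\ell}\,\varepsilon\right)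 \le \frac{\varepsilon\, r}{(\ell-1)!}\left(C' \log\frac1\varepsilon\right)^{\ell}.$$ -/

import Mathlib

open MeasureTheory ProbabilityTheory

/-- The `n ^ ℓ × r` matrix whose `i`-th column is the flattened simple tensor
`x i 1 ⊗ ⋯ ⊗ x i ℓ` in `(ℝⁿ)^{⊗ ℓ}`. Its rows are indexed by the `n ^ ℓ` multi-indices
`k = (k 1, …, k ℓ)`, and the entry of the tensor at `k` is `∏ j, (x i j) (k j)`. -/
def tensorMatrix {n ℓ r : ℕ} (x : Fin r → Fin ℓ → EuclideanSpace ℝ (Fin n)) :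
    Matrix (Fin ℓ → Fin n) (Fin r) ℝ :=
  Matrix.of fun k i => ∏ j, x i j (k j)

/-- The smallest singular value of a real matrix with `r ≥ 1` columns and at least `r` rows:
the last one of its `r` singular values `s_1 ≥ ⋯ ≥ s_r ≥ 0`, the square roots of the
eigenvalues of `Aᵀ A` (Mathlib numbers them from `0`). -/
noncomputable def sMin {ι : Type*} [Fintype ι] {r : ℕ} (A : Matrix ι (Fin r) ℝ) : ℝ :=
  (Matrix.toLpLin 2 2 A).singularValues (r - 1)

open MeasureTheory ProbabilityTheory
open scoped ENNReal NNReal Matrix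

/-! The bound is Markov's inequality for a negative moment of order `s` just below 1/2. Take a unit
vector `v` with `‖A v‖ = sMin A ≤ θ`. Then `v i ^ 2` times the squared distance from column `i` to
the span of the others is at most `θ²`. With the distance regularized at scale `δ = θ²` the bound
becomes `2θ²`. Since the `v i ^ 2` sum to 1, the sum of these squared distances to the power `-s` is
at least `(2θ²)^(-s)` (`one_le_sum_columnForm_rpow_neg`).

Given the other columns, the regularized squared distance is a positive semidefinite form `Q`
evaluated at a random simple tensor, and the trace of `Q` is at least the codimension
(`le_trace_ridge`). Writing `Q` as a sum of rank-one forms gives a sum of squares of multilinear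
forms. Jensen and induction on `ℓ` reduce its negative moment to that of a one-dimensional Gaussian,
at a cost of one factor of order `1 / (1 - 2s)` per tensor factor
(`lintegral_pi_tensor_rpow_neg_le`).

The choice `1 - 2s = ℓ / log (1/ε)` balances these factors against `ε^(2s) = ε e^ℓ`. -/

/-! ### Negative powers and one-dimensional Gaussians -/

/-- Jensen's inequality for the convex function `x ↦ x ^ (-s)`, in `ℝ≥0∞`. -/
theorem ENNReal.rpow_neg_sum_le {κ : Type*} [Fintype κ] {s : ℝ} (hs : 0 < s)
    (p z : κ → ℝ) (hp : ∀ k, 0 ≤ p k) (hp1 : ∑ k, p k = 1) (hz : ∀ k, 0 ≤ z k) :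
    ENNReal.ofReal (∑ k, p k * z k) ^ (-s) ≤
      ∑ k, ENNReal.ofReal (p k) * ENNReal.ofReal (z k) ^ (-s) := by
  classical
  by_cases h : ∃ k, 0 < p k ∧ z k = 0
  · obtain ⟨k, hk, hk0⟩ := h
    have : ENNReal.ofReal (p k) * ENNReal.ofReal (z k) ^ (-s) = ⊤ := by
      rw [hk0, ENNReal.ofReal_zero, ENNReal.zero_rpow_of_neg (by linarith)]
      exact ENNReal.mul_top (by simpa using hk)
    rw [ENNReal.sum_eq_top.2 ⟨k, Finset.mem_univ k, this⟩]
    exact le_top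
  push Not at h
  -- Values of weight zero do not matter; replacing them by 1 makes every value positive.
  set w : κ → ℝ := fun k => if p k = 0 then 1 else z k with hw
  have hw0 : ∀ k, 0 < w k := by
    intro k
    simp only [hw]
    split_ifs with h0
    · exact one_pos
    · exact (hz k).lt_of_ne' (h k ((hp k).lt_of_ne' h0))
  have e1 : ∑ k, p k * z k = ∑ k, p k * w k := by
    refine Finset.sum_congr rfl fun k _ => ?_
    simp only [hw]
    split_ifs with h0 <;> simp [h0]
  have e2 : ∑ k, ENNReal.ofReal (p k) * ENNReal.ofReal (z k) ^ (-s) =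
      ∑ k, ENNReal.ofReal (p k) * ENNReal.ofReal (w k) ^ (-s) := by
    refine Finset.sum_congr rfl fun k _ => ?_
    simp only [hw]
    split_ifs with h0 <;> simp [h0]
  -- AM-GM twice: the `-s` power of the geometric mean of `w` is the geometric mean of `w ^ (-s)`.
  have key : (∑ k, p k * w k) ^ (-s) ≤ ∑ k, p k * w k ^ (-s) := by
    have hprod : 0 < ∏ k, w k ^ p k := Finset.prod_pos fun k _ => Real.rpow_pos_of_pos (hw0 k) _
    have g1 := Real.geom_mean_le_arith_mean_weighted Finset.univ p w (fun k _ => hp k) hp1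
      (fun k _ => (hw0 k).le)
    have g2 := Real.geom_mean_le_arith_mean_weighted Finset.univ p (fun k => w k ^ (-s))
      (fun k _ => hp k) hp1 (fun k _ => (Real.rpow_pos_of_pos (hw0 k) _).le)
    refine (Real.rpow_le_rpow_of_nonpos hprod g1 (by linarith)).trans (le_trans (le_of_eq ?_) g2)
    rw [← Real.finsetProd_rpow _ _ fun k _ => (Real.rpow_pos_of_pos (hw0 k) _).le]
    refine Finset.prod_congr rfl fun k _ => ?_
    rw [← Real.rpow_mul (hw0 k).le, ← Real.rpow_mul (hw0 k).le, mul_comm]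
  have hpos : 0 < ∑ k, p k * w k := by
    obtain ⟨k, hk⟩ : ∃ k, p k ≠ 0 := by
      by_contra! hcon
      simp [hcon] at hp1
    exact Finset.sum_pos' (fun k _ => mul_nonneg (hp k) (hw0 k).le)
      ⟨k, Finset.mem_univ k, _root_.mul_pos ((hp k).lt_of_ne' hk) (hw0 k)⟩
  rw [e1, e2, ENNReal.ofReal_rpow_of_pos hpos]
  refine (ENNReal.ofReal_le_ofReal key).trans (le_of_eq ?_)
  rw [ENNReal.ofReal_sum_of_nonneg fun k _ =>
    mul_nonneg (hp k) (Real.rpow_pos_of_pos (hw0 k) _).le]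
  refine Finset.sum_congr rfl fun k _ => ?_
  rw [ENNReal.ofReal_mul (hp k), ENNReal.ofReal_rpow_of_pos (hw0 k)]

theorem lintegral_Ioc_sq_rpow_neg {s : ℝ} (hs : s < 1 / 2) {b : ℝ} (hb : 0 < b) :
    ∫⁻ z in Set.Ioc 0 b, ENNReal.ofReal (z ^ 2) ^ (-s) =
      ENNReal.ofReal (b ^ (1 - 2 * s) / (1 - 2 * s)) := by
  have h1 : ∫⁻ z in Set.Ioc 0 b, ENNReal.ofReal (z ^ 2) ^ (-s) =
      ∫⁻ z in Set.Ioc 0 b, ENNReal.ofReal (z ^ (-2 * s)) := by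
    refine setLIntegral_congr_fun measurableSet_Ioc fun z hz => ?_
    have hz0 : 0 < z := hz.1
    rw [ENNReal.ofReal_rpow_of_pos (by positivity), ← Real.rpow_natCast, ← Real.rpow_mul hz0.le]
    congr 2
    push_cast
    ring
  rw [h1, ← ofReal_integral_eq_lintegral_ofReal]
  · rw [← intervalIntegral.integral_of_le hb.le, integral_rpow (Or.inl (by linarith)),
      Real.zero_rpow (by linarith), show -2 * s + 1 = 1 - 2 * s by ring, sub_zero]
  · exact (intervalIntegrable_iff_integrableOn_Ioc_of_le hb.le).1
      (intervalIntegral.intervalIntegrable_rpow' (by linarith))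
  · exact (ae_restrict_iff' measurableSet_Ioc).2
      (Filter.Eventually.of_forall fun z hz => Real.rpow_nonneg hz.1.le _)

theorem lintegral_Icc_sq_rpow_neg_le {s : ℝ} (hs : s < 1 / 2) {b : ℝ} (hb : 0 < b) :
    ∫⁻ z in Set.Icc (-b) b, ENNReal.ofReal (z ^ 2) ^ (-s) ≤
      2 * ENNReal.ofReal (b ^ (1 - 2 * s) / (1 - 2 * s)) := by
  have hsub : Set.Icc (-b) b ⊆ Set.Icc (-b) 0 ∪ Set.Ioc 0 b := by
    intro z hz
    rcases le_or_gt z 0 with h | h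
    · exact Or.inl ⟨hz.1, h⟩
    · exact Or.inr ⟨h, hz.2⟩
  have hneg : ∫⁻ z in Set.Icc (-b) 0, ENNReal.ofReal (z ^ 2) ^ (-s) =
      ∫⁻ z in Set.Ioc 0 b, ENNReal.ofReal (z ^ 2) ^ (-s) := by
    have := (Measure.measurePreserving_neg (volume : Measure ℝ)).setLIntegral_comp_preimage
      (measurableSet_Icc (a := (0 : ℝ)) (b := b))
      (f := fun z => ENNReal.ofReal (z ^ 2) ^ (-s)) (by fun_prop)
    simp only [neg_sq] at this
    rw [setLIntegral_congr (Ioc_ae_eq_Icc (a := (0 : ℝ)) (b := b)), ← this]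
    congr 2
    ext z
    simp only [Set.mem_Icc, Set.mem_preimage]
    constructor <;> rintro ⟨h1, h2⟩ <;> constructor <;> linarith
  calc _ ≤ ∫⁻ z in Set.Icc (-b) 0 ∪ Set.Ioc 0 b, ENNReal.ofReal (z ^ 2) ^ (-s) :=
        lintegral_mono_set hsub
    _ ≤ _ := lintegral_union_le _ _ _
    _ = _ := by rw [hneg, lintegral_Ioc_sq_rpow_neg hs hb, ← two_mul]

theorem gaussianPDF_le (a : ℝ) (v : ℝ≥0) (x : ℝ) :
    gaussianPDF a v x ≤ ENNReal.ofReal (√(2 * Real.pi * v))⁻¹ := by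
  refine ENNReal.ofReal_le_ofReal ?_
  rw [gaussianPDFReal]
  refine mul_le_of_le_one_right (by positivity) (Real.exp_le_one_iff.2 ?_)
  exact div_nonpos_of_nonpos_of_nonneg (by nlinarith [sq_nonneg (x - a)]) (by positivity)

/-- Negative moments of a (not necessarily centred) Gaussian variable. -/
theorem lintegral_gaussianReal_sq_rpow_neg_le {s : ℝ} (hs0 : 0 < s) (hs : s < 1 / 2) (a : ℝ)
    (v : ℝ≥0) :
    ∫⁻ z, ENNReal.ofReal (z ^ 2) ^ (-s) ∂(gaussianReal a v) ≤
      ENNReal.ofReal (2 / (1 - 2 * s)) * ENNReal.ofReal v ^ (-s) := by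
  have hs' : 0 < 1 - 2 * s := by linarith
  rcases eq_or_ne v 0 with rfl | hv
  · rw [NNReal.coe_zero, ENNReal.ofReal_zero, ENNReal.zero_rpow_of_neg (by linarith),
      ENNReal.mul_top (ENNReal.ofReal_pos.2 (by positivity)).ne']
    exact le_top
  have hv0 : (0 : ℝ) < v := by positivity
  set b : ℝ := √v with hb
  have hb0 : 0 < b := Real.sqrt_pos.2 hv0
  have hb2 : b ^ 2 = v := Real.sq_sqrt hv0.le
  set f : ℝ → ℝ≥0∞ := fun z => ENNReal.ofReal (z ^ 2) ^ (-s) with hf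
  have hfm : Measurable f := by fun_prop
  -- Beyond one standard deviation `b` the integrand is at most `v ^ (-s)`; inside, the density is
  -- bounded by its maximum, wherever the mean lies.
  have hle : ∀ z, f z ≤ ENNReal.ofReal v ^ (-s) + (Set.Icc (-b) b).indicator f z := by
    intro z
    by_cases hz : z ∈ Set.Icc (-b) b
    · rw [Set.indicator_of_mem hz]
      exact le_add_self
    · rw [Set.indicator_of_notMem hz, add_zero]
      have : (v : ℝ) ≤ z ^ 2 := by
        rw [← hb2]
        rw [Set.mem_Icc, ← abs_le, not_le] at hz
        rw [← sq_abs z]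
        exact pow_le_pow_left₀ hb0.le hz.le 2
      simp only [hf, ENNReal.rpow_neg]
      gcongr
  have hind : ∫⁻ z, (Set.Icc (-b) b).indicator f z ∂(gaussianReal a v) ≤
      ENNReal.ofReal (1 / (1 - 2 * s)) * ENNReal.ofReal v ^ (-s) := by
    rw [gaussianReal_of_var_ne_zero a hv, lintegral_withDensity_eq_lintegral_mul _
      (measurable_gaussianPDF a v) (hfm.indicator measurableSet_Icc)]
    calc _ ≤ ∫⁻ z, ENNReal.ofReal (√(2 * Real.pi * v))⁻¹ * (Set.Icc (-b) b).indicator f z := by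
          refine lintegral_mono fun z => ?_
          simp only [Pi.mul_apply]
          gcongr
          exact gaussianPDF_le a v z
      _ = ENNReal.ofReal (√(2 * Real.pi * v))⁻¹ * ∫⁻ z in Set.Icc (-b) b, f z := by
          rw [lintegral_const_mul _ (hfm.indicator measurableSet_Icc),
            lintegral_indicator measurableSet_Icc]
      _ ≤ ENNReal.ofReal (√(2 * Real.pi * v))⁻¹ *
            (2 * ENNReal.ofReal (b ^ (1 - 2 * s) / (1 - 2 * s))) := by
          gcongr
          exact lintegral_Icc_sq_rpow_neg_le hs hb0
      _ ≤ _ := by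
          rw [ENNReal.ofReal_rpow_of_pos hv0, show (2 : ℝ≥0∞) = ENNReal.ofReal 2 by simp,
            ← ENNReal.ofReal_mul (by positivity), ← ENNReal.ofReal_mul (by positivity),
            ← ENNReal.ofReal_mul (by positivity)]
          refine ENNReal.ofReal_le_ofReal ?_
          have hbr : b ^ (1 - 2 * s) = b * (v : ℝ) ^ (-s) := by
            rw [← hb2, ← Real.rpow_natCast b 2, ← Real.rpow_mul hb0.le, sub_eq_add_neg,
              Real.rpow_add hb0, Real.rpow_one]
            congr 2
            push_cast
            ring
          have hroot : 2 * b ≤ √(2 * Real.pi * v) := by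
            refine Real.le_sqrt_of_sq_le ?_
            rw [mul_pow, hb2]
            nlinarith [Real.pi_gt_three]
          rw [hbr]
          have hpos : 0 < √(2 * Real.pi * v) := by positivity
          rw [show (√(2 * Real.pi * v))⁻¹ * (2 * (b * (v : ℝ) ^ (-s) / (1 - 2 * s))) =
            ((√(2 * Real.pi * v))⁻¹ * (2 * b)) * (1 / (1 - 2 * s) * (v : ℝ) ^ (-s)) by ring]
          refine mul_le_of_le_one_left (by positivity) ?_
          rw [inv_mul_le_iff₀ hpos, mul_one]
          exact hroot
  calc _ ≤ ∫⁻ z, (ENNReal.ofReal v ^ (-s) + (Set.Icc (-b) b).indicator f z)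
          ∂(gaussianReal a v) := lintegral_mono hle
    _ = ENNReal.ofReal v ^ (-s) +
          ∫⁻ z, (Set.Icc (-b) b).indicator f z ∂(gaussianReal a v) := by
        rw [lintegral_add_left measurable_const, lintegral_const, measure_univ, mul_one]
    _ ≤ 1 * ENNReal.ofReal v ^ (-s) +
          ENNReal.ofReal (1 / (1 - 2 * s)) * ENNReal.ofReal v ^ (-s) := by
        rw [one_mul]
        gcongr
    _ ≤ _ := by
        rw [← add_mul, ← ENNReal.ofReal_one, ← ENNReal.ofReal_add (by positivity) (by positivity)]
        gcongr
        rw [← le_sub_iff_add_le, ← sub_div, le_div_iff₀ hs']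
        linarith

/-! ### Negative moments of linear and multilinear forms -/

/-- The hypothesis that `∫ (⟨u, y⟩²)^(-s) ∂μ ≤ D (‖u‖²)^(-s)` for every vector `u`. -/
def NegMomentBound {ι : Type*} [Fintype ι] (s : ℝ) (D : ℝ≥0∞)
    (μ : Measure (EuclideanSpace ℝ ι)) : Prop :=
  ∀ u : ι → ℝ, ∫⁻ y, ENNReal.ofReal ((∑ i, u i * y i) ^ 2) ^ (-s) ∂μ ≤
    D * ENNReal.ofReal (∑ i, u i ^ 2) ^ (-s)

/-- Convexity lets a sum of squares cost no more than a single square: it is a weighted average of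
squares of forms that all have the same norm. -/
theorem NegMomentBound.sum_sq {ι κ : Type*} [Fintype ι] [Fintype κ] {s : ℝ} (hs : 0 < s)
    {D : ℝ≥0∞} {μ : Measure (EuclideanSpace ℝ ι)} (h : NegMomentBound s D μ)
    (u : κ → ι → ℝ) :
    ∫⁻ y, ENNReal.ofReal (∑ k, (∑ i, u k i * y i) ^ 2) ^ (-s) ∂μ ≤
      D * ENNReal.ofReal (∑ k, ∑ i, u k i ^ 2) ^ (-s) := by
  set τ := ∑ k, ∑ i, u k i ^ 2 with hτ
  set q : κ → ℝ := fun k => ∑ i, u k i ^ 2 with hq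
  have hq0 : ∀ k, 0 ≤ q k := fun k => Finset.sum_nonneg fun i _ => sq_nonneg _
  have hτ0 : 0 ≤ τ := Finset.sum_nonneg fun k _ => hq0 k
  have hzero : ∀ k, q k = 0 → ∀ i, u k i = 0 := by
    intro k hk i
    have := (Finset.sum_eq_zero_iff_of_nonneg fun i _ => sq_nonneg (u k i)).1 hk i
      (Finset.mem_univ i)
    simpa using this
  rcases hτ0.eq_or_lt with h0 | hpos
  · have hz : ∀ k i, u k i = 0 := fun k => hzero k
      ((Finset.sum_eq_zero_iff_of_nonneg fun k _ => hq0 k).1 h0.symm k (Finset.mem_univ k))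
    have := h 0
    rw [← h0]
    simpa [hz] using this
  -- Each nonzero row is rescaled to squared norm `τ`; the weights `q k / τ` sum to 1.
  set e : κ → ι → ℝ := fun k i => √(τ / q k) * u k i with he
  have hnorm : ∀ k, 0 < q k → ∑ i, e k i ^ 2 = τ := by
    intro k hk
    simp only [he, mul_pow, ← Finset.mul_sum]
    rw [Real.sq_sqrt (div_nonneg hτ0 hk.le)]
    exact div_mul_cancel₀ _ hk.ne'
  have hsplit : ∀ (y : EuclideanSpace ℝ ι), ∑ k, (∑ i, u k i * y i) ^ 2 =
      ∑ k, q k / τ * (∑ i, e k i * y i) ^ 2 := by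
    intro y
    refine Finset.sum_congr rfl fun k _ => ?_
    rcases (hq0 k).eq_or_lt with hk | hk
    · simp [← hk, hzero k hk.symm]
    · simp only [he, mul_assoc, ← Finset.mul_sum]
      rw [mul_pow, Real.sq_sqrt (div_nonneg hτ0 hk.le)]
      field_simp
  calc _ ≤ ∫⁻ y, ∑ k, ENNReal.ofReal (q k / τ) *
          ENNReal.ofReal ((∑ i, e k i * y i) ^ 2) ^ (-s) ∂μ := by
        refine lintegral_mono fun y => ?_
        simp only
        rw [hsplit y]
        refine ENNReal.rpow_neg_sum_le hs _ _ (fun k => div_nonneg (hq0 k) hτ0) ?_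
          (fun k => sq_nonneg _)
        rw [← Finset.sum_div]
        exact div_self hpos.ne'
    _ = ∑ k, ENNReal.ofReal (q k / τ) *
          ∫⁻ y, ENNReal.ofReal ((∑ i, e k i * y i) ^ 2) ^ (-s) ∂μ := by
        rw [lintegral_finsetSum _ fun k _ => by fun_prop]
        exact Finset.sum_congr rfl fun k _ => lintegral_const_mul _ (by fun_prop)
    _ ≤ ∑ k, ENNReal.ofReal (q k / τ) * (D * ENNReal.ofReal τ ^ (-s)) := by
        refine Finset.sum_le_sum fun k _ => ?_
        rcases (hq0 k).eq_or_lt with hk | hk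
        · simp [← hk]
        · have := h (e k)
          rw [hnorm k hk] at this
          gcongr
    _ = _ := by
        rw [← Finset.sum_mul, ← ENNReal.ofReal_sum_of_nonneg fun k _ => div_nonneg (hq0 k) hτ0,
          ← Finset.sum_div, show ∑ k, q k = τ from rfl, div_self hpos.ne', ENNReal.ofReal_one,
          one_mul]

/-- Decoupled negative moments: a sum of squares of multilinear forms in independent vectors. -/
theorem lintegral_pi_tensor_rpow_neg_le {n : ℕ} {s : ℝ} (hs : 0 < s) {D : ℝ≥0∞} :
    ∀ {ℓ : ℕ} {κ : Type} [Fintype κ] (μ : Fin ℓ → Measure (EuclideanSpace ℝ (Fin n)))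
      [∀ j, IsProbabilityMeasure (μ j)], (∀ j, NegMomentBound s D (μ j)) →
      ∀ w : κ → (Fin ℓ → Fin n) → ℝ,
      ∫⁻ y, ENNReal.ofReal (∑ k, (∑ m, w k m * ∏ j, y j (m j)) ^ 2) ^ (-s) ∂(Measure.pi μ) ≤
        D ^ ℓ * ENNReal.ofReal (∑ k, ∑ m, w k m ^ 2) ^ (-s)
  | 0, κ, _, μ, _, hμ, w => by simp
  | ℓ + 1, κ, _, μ, _, hμ, w => by
    have hmp := measurePreserving_piFinSuccAbove μ 0
    set F : EuclideanSpace ℝ (Fin n) × (Fin ℓ → EuclideanSpace ℝ (Fin n)) → ℝ≥0∞ := fun z =>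
      ENNReal.ofReal (∑ k, (∑ m : Fin ℓ → Fin n,
        (∑ i, w k (Fin.cons i m) * z.1 i) * ∏ j, z.2 j (m j)) ^ 2) ^ (-s) with hF
    have hFm : Measurable F := by fun_prop
    have hsum : ∀ g : (Fin (ℓ + 1) → Fin n) → ℝ,
        ∑ m, g m = ∑ m : Fin ℓ → Fin n, ∑ i, g (Fin.cons i m) := by
      intro g
      rw [← (Fin.consEquiv fun _ => Fin n).sum_comp, Fintype.sum_prod_type_right]
      rfl
    have heq : ∀ y : Fin (ℓ + 1) → EuclideanSpace ℝ (Fin n),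
        ENNReal.ofReal (∑ k, (∑ m, w k m * ∏ j, y j (m j)) ^ 2) ^ (-s) =
          F (MeasurableEquiv.piFinSuccAbove (fun _ => EuclideanSpace ℝ (Fin n)) 0 y) := by
      intro y
      simp only [hF, hsum, Fin.prod_univ_succ, Finset.sum_mul, Fin.cons_zero, Fin.cons_succ,
        mul_assoc]
      rfl
    simp_rw [heq]
    rw [hmp.lintegral_comp hFm, lintegral_prod _ hFm.aemeasurable]
    -- With the first vector frozen, induction handles the rest. What remains is a sum of squares of
    -- linear forms in that vector, indexed by pairs `(k, m)`.
    calc _ ≤ ∫⁻ y, D ^ ℓ * ENNReal.ofReal (∑ k, ∑ m : Fin ℓ → Fin n,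
            (∑ i, w k (Fin.cons i m) * y i) ^ 2) ^ (-s) ∂(μ 0) := by
          refine lintegral_mono fun y => ?_
          exact lintegral_pi_tensor_rpow_neg_le hs (fun j => μ (Fin.succAbove 0 j))
            (fun j => hμ _) fun k m => ∑ i, w k (Fin.cons i m) * y i
      _ = D ^ ℓ * ∫⁻ y, ENNReal.ofReal (∑ k : κ × (Fin ℓ → Fin n),
            (∑ i, w k.1 (Fin.cons i k.2) * y i) ^ 2) ^ (-s) ∂(μ 0) := by
          rw [lintegral_const_mul _ (by fun_prop)]
          simp_rw [Fintype.sum_prod_type]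
      _ ≤ D ^ ℓ * (D * ENNReal.ofReal (∑ k : κ × (Fin ℓ → Fin n),
            ∑ i, w k.1 (Fin.cons i k.2) ^ 2) ^ (-s)) := by
          gcongr
          exact (hμ 0).sum_sq hs fun (k : κ × (Fin ℓ → Fin n)) i => w k.1 (Fin.cons i k.2)
      _ = _ := by
          rw [← mul_assoc, ← pow_succ]
          simp only [hsum, Fintype.sum_prod_type]

/-- Pairing with `u` gives a one-dimensional Gaussian of variance `v ‖u‖²`; the shift `x` only moves
its mean, which the scalar bound ignores. -/
theorem negMomentBound_multivariateGaussian {ι : Type*} [Fintype ι] [DecidableEq ι] {s : ℝ}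
    (hs0 : 0 < s) (hs : s < 1 / 2) {v : ℝ} (hv : 0 < v) (x : EuclideanSpace ℝ ι) :
    NegMomentBound s (ENNReal.ofReal (2 / (1 - 2 * s)) * ENNReal.ofReal v ^ (-s))
      ((multivariateGaussian 0 (v • (1 : Matrix ι ι ℝ))).map (x + ·)) := by
  intro u
  have hS : (v • (1 : Matrix ι ι ℝ)).PosSemidef := Matrix.PosSemidef.one.smul hv.le
  set γ := multivariateGaussian 0 (v • (1 : Matrix ι ι ℝ)) with hγ
  set L : StrongDual ℝ (EuclideanSpace ℝ ι) := innerSL ℝ (WithLp.toLp 2 u) with hL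
  have hLapp : ∀ y, L y = ∑ i, u i * y i := by
    intro y
    simp [hL, PiLp.inner_apply, mul_comm]
  have hvar : Var[L; γ] = v * ∑ i, u i ^ 2 := by
    have h1 := covarianceBilin_self (μ := γ) IsGaussian.memLp_two_id (WithLp.toLp 2 u)
    rw [hγ, covarianceBilin_multivariateGaussian hS] at h1
    refine Eq.trans h1.symm ?_
    simp [Matrix.smul_mulVec, dotProduct, Finset.mul_sum]
    refine Finset.sum_congr rfl fun i _ => ?_
    ring
  set w : ℝ≥0 := Var[L; γ].toNNReal with hw
  have hlaw : γ.map L = gaussianReal γ[L] w := IsGaussian.map_eq_gaussianReal L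
  have hwv : ENNReal.ofReal (w : ℝ) ^ (-s) =
      ENNReal.ofReal v ^ (-s) * ENNReal.ofReal (∑ i, u i ^ 2) ^ (-s) := by
    rw [hw, hvar, Real.coe_toNNReal _ (by positivity), ENNReal.ofReal_mul hv.le,
      ENNReal.mul_rpow_of_ne_top ENNReal.ofReal_ne_top ENNReal.ofReal_ne_top]
  have hmap : (γ.map (x + ·)).map L = gaussianReal (γ[L] + L x) w := by
    rw [Measure.map_map (by fun_prop) (by fun_prop)]
    have : (L ∘ fun y => x + y) = (fun t => t + L x) ∘ L := by
      funext y
      rw [Function.comp_apply, Function.comp_apply, map_add, add_comm]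
    rw [this, ← Measure.map_map (by fun_prop) (by fun_prop), hlaw, gaussianReal_map_add_const]
  calc _ = ∫⁻ z, ENNReal.ofReal (z ^ 2) ^ (-s) ∂((γ.map (x + ·)).map L) := by
        refine Eq.symm ((lintegral_map (f := fun z : ℝ => ENNReal.ofReal (z ^ 2) ^ (-s))
          (by fun_prop) (by fun_prop)).trans (lintegral_congr fun y => ?_))
        rw [hLapp]
    _ ≤ _ := by
        rw [hmap, mul_assoc, ← hwv]
        exact lintegral_gaussianReal_sq_rpow_neg_le hs0 hs _ _

/-! ### The regularized projection -/

section Ridge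

variable {ι κ : Type*} [Fintype ι] [DecidableEq ι] [Fintype κ]

/-- The matrix `δ (δ + B Bᵀ)⁻¹`, a regularization of the orthogonal projection onto the orthogonal
complement of the column space of `B`. -/
noncomputable def ridge (δ : ℝ) (B : Matrix ι κ ℝ) : Matrix ι ι ℝ :=
  δ • (δ • (1 : Matrix ι ι ℝ) + B * Bᵀ)⁻¹

theorem posDef_smul_one_add {δ : ℝ} (hδ : 0 < δ) (B : Matrix ι κ ℝ) :
    (δ • (1 : Matrix ι ι ℝ) + B * Bᵀ).PosDef :=
  (Matrix.PosDef.one.smul hδ).add_posSemidef (Matrix.posSemidef_self_mul_conjTranspose B)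

theorem posSemidef_ridge {δ : ℝ} (hδ : 0 < δ) (B : Matrix ι κ ℝ) : (ridge δ B).PosSemidef :=
  (posDef_smul_one_add hδ B).inv.posSemidef.smul hδ.le

/-- Completing the square. -/
theorem dotProduct_ridge_mulVec_le {δ : ℝ} (hδ : 0 < δ) (B : Matrix ι κ ℝ) (a : ι → ℝ)
    (u : κ → ℝ) :
    a ⬝ᵥ ridge δ B *ᵥ a ≤ (a + B *ᵥ u) ⬝ᵥ (a + B *ᵥ u) + δ * (u ⬝ᵥ u) := by
  set N := δ • (1 : Matrix ι ι ℝ) + B * Bᵀ with hN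
  set z := N⁻¹ *ᵥ a with hz
  set b := Bᵀ *ᵥ z with hb
  have hdet : IsUnit N.det :=
    (Matrix.isUnit_iff_isUnit_det N).1 (posDef_smul_one_add hδ B).isUnit
  have ha : a = δ • z + B *ᵥ b := by
    have : N *ᵥ z = a := by
      rw [hz, Matrix.mulVec_mulVec, Matrix.mul_nonsing_inv _ hdet, Matrix.one_mulVec]
    rw [hb, Matrix.mulVec_mulVec, ← this, hN, Matrix.add_mulVec, Matrix.smul_mulVec,
      Matrix.one_mulVec]
  have hq : a ⬝ᵥ ridge δ B *ᵥ a = δ * (a ⬝ᵥ z) := by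
    rw [ridge, Matrix.smul_mulVec, dotProduct_smul, smul_eq_mul]
  have hadj : ∀ w : κ → ℝ, (B *ᵥ w) ⬝ᵥ z = w ⬝ᵥ b := by
    intro w
    rw [hb, Matrix.mulVec_transpose, dotProduct_comm, Matrix.dotProduct_mulVec, dotProduct_comm]
  have haz : a ⬝ᵥ z = δ * (z ⬝ᵥ z) + b ⬝ᵥ b := by
    conv_lhs => rw [ha]
    rw [add_dotProduct, smul_dotProduct, smul_eq_mul, hadj]
  -- In these variables the right side minus the left is `‖B w‖² + δ ‖w‖²`.
  set w := b + u with hw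
  have hu : u = w - b := by rw [hw]; abel
  have hau : a + B *ᵥ u = δ • z + B *ᵥ w := by
    rw [hw, Matrix.mulVec_add, ha]
    abel
  have hpos : 0 ≤ (B *ᵥ w) ⬝ᵥ (B *ᵥ w) := Finset.sum_nonneg fun _ _ => mul_self_nonneg _
  have hpos' : 0 ≤ w ⬝ᵥ w := Finset.sum_nonneg fun _ _ => mul_self_nonneg _
  rw [hq, haz, hau, hu]
  simp only [add_dotProduct, dotProduct_add, sub_dotProduct, dotProduct_sub, smul_dotProduct,
    dotProduct_smul, smul_eq_mul, hadj, dotProduct_comm z (B *ᵥ w), dotProduct_comm b w]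
  nlinarith [mul_nonneg hδ.le hpos']

theorem sq_mul_dotProduct_ridge_mulVec_le {δ : ℝ} (hδ : 0 < δ) (B : Matrix ι κ ℝ) (a : ι → ℝ)
    (t : ℝ) (u : κ → ℝ) :
    t ^ 2 * (a ⬝ᵥ ridge δ B *ᵥ a) ≤ (t • a + B *ᵥ u) ⬝ᵥ (t • a + B *ᵥ u) + δ * (u ⬝ᵥ u) := by
  refine le_trans (le_of_eq ?_) (dotProduct_ridge_mulVec_le hδ B (t • a) u)
  rw [Matrix.mulVec_smul, smul_dotProduct, dotProduct_smul, smul_eq_mul, smul_eq_mul]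
  ring

/-- The trace of `ridge δ B` is at least the number of rows minus the number of columns. -/
theorem le_trace_ridge {δ : ℝ} (hδ : 0 < δ) (B : Matrix ι κ ℝ) :
    (Fintype.card ι : ℝ) - Fintype.card κ ≤ (ridge δ B).trace := by
  set N := δ • (1 : Matrix ι ι ℝ) + B * Bᵀ with hN
  have hdet : IsUnit N.det :=
    (Matrix.isUnit_iff_isUnit_det N).1 (posDef_smul_one_add hδ B).isUnit
  have hdecomp : ridge δ B = 1 - B * Bᵀ * N⁻¹ := by
    have : N * N⁻¹ = 1 := Matrix.mul_nonsing_inv _ hdet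
    rw [eq_sub_iff_add_eq, ← this, hN, Matrix.add_mul, Matrix.smul_mul, Matrix.one_mul]
    rfl
  have hcol : ∀ k, (Bᵀ * N⁻¹ * B) k k ≤ 1 := by
    intro k
    classical
    -- Taking `u = -e_k` cancels column `k` of `B`, so only the penalty `δ` remains.
    have h := dotProduct_ridge_mulVec_le hδ B (B.col k) (-Pi.single k 1)
    rw [Matrix.mulVec_neg, Matrix.mulVec_single_one, add_neg_cancel, zero_dotProduct, zero_add,
      neg_dotProduct_neg, dotProduct_single_one, Pi.single_eq_same, mul_one, ridge,
      Matrix.smul_mulVec, dotProduct_smul, smul_eq_mul] at h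
    have h1 : (Bᵀ * N⁻¹ * B) k k = B.col k ⬝ᵥ N⁻¹ *ᵥ B.col k := by
      rw [Matrix.mul_assoc]
      rfl
    rw [h1]
    exact le_of_mul_le_mul_left (h.trans_eq (mul_one δ).symm) hδ
  rw [hdecomp, Matrix.trace_sub, Matrix.trace_one, Matrix.mul_assoc, Matrix.trace_mul_comm]
  have : (Bᵀ * N⁻¹ * B).trace ≤ ∑ _k : κ, (1 : ℝ) := Finset.sum_le_sum fun k _ => hcol k
  simp only [Finset.sum_const, Finset.card_univ, nsmul_eq_mul, mul_one] at this
  linarith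

/-- Needed for the measurability of the column forms. -/
theorem continuous_ridge {δ : ℝ} (hδ : 0 < δ) :
    Continuous (ridge δ : Matrix ι κ ℝ → Matrix ι ι ℝ) := by
  unfold ridge
  simp_rw [Matrix.inv_def, Ring.inverse_eq_inv']
  have hN : Continuous fun B : Matrix ι κ ℝ => δ • (1 : Matrix ι ι ℝ) + B * Bᵀ := by fun_prop
  refine ((hN.matrix_det.inv₀ fun B => ?_).smul hN.matrix_adjugate).const_smul δ
  exact ((Matrix.isUnit_iff_isUnit_det _).1 (posDef_smul_one_add hδ B).isUnit).ne_zero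

end Ridge

/-! ### Smallest singular value and column distances -/

theorem EuclideanSpace.ofLp_dotProduct_self {ι : Type*} [Fintype ι] (y : EuclideanSpace ℝ ι) :
    y.ofLp ⬝ᵥ y.ofLp = ‖y‖ ^ 2 := by
  rw [EuclideanSpace.real_norm_sq_eq, dotProduct]
  exact Finset.sum_congr rfl fun i _ => (sq _).symm

/-- A unit vector realizing the smallest singular value. -/
theorem exists_unit_mulVec_sMin {ι : Type*} [Fintype ι] {r : ℕ} (A : Matrix ι (Fin (r + 1)) ℝ) :
    ∃ v : Fin (r + 1) → ℝ, v ⬝ᵥ v = 1 ∧ (A *ᵥ v) ⬝ᵥ (A *ᵥ v) = sMin A ^ 2 := by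
  classical
  set T := Matrix.toLpLin 2 2 A with hT
  have hr : r < Module.finrank ℝ (EuclideanSpace ℝ (Fin (r + 1))) := by simp
  have hev := T.hasEigenvalue_adjoint_comp_self_sq_singularValues hr
  obtain ⟨x, hx⟩ := hev.exists_hasEigenvector
  have hx0 : 0 < ‖x‖ := norm_pos_iff.2 hx.2
  have hTx : ‖T x‖ ^ 2 = T.singularValues r ^ 2 * ‖x‖ ^ 2 := by
    have h1 : inner ℝ (T x) (T x) = inner ℝ x ((LinearMap.adjoint T ∘ₗ T) x) := by
      rw [LinearMap.comp_apply, LinearMap.adjoint_inner_right]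
    rw [hx.apply_eq_smul, real_inner_smul_right, real_inner_self_eq_norm_sq,
      real_inner_self_eq_norm_sq] at h1
    exact h1
  refine ⟨(‖x‖⁻¹ • x).ofLp, ?_, ?_⟩
  · rw [EuclideanSpace.ofLp_dotProduct_self, norm_smul, norm_inv, norm_norm, inv_mul_cancel₀ hx0.ne', one_pow]
  · have : A *ᵥ (‖x‖⁻¹ • x).ofLp = (T (‖x‖⁻¹ • x)).ofLp := by
      rw [hT, Matrix.ofLp_toLpLin, Matrix.toLin'_apply]
    rw [this, EuclideanSpace.ofLp_dotProduct_self, map_smul, norm_smul, mul_pow, hTx, norm_inv, norm_norm]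
    have hs : sMin A = T.singularValues r := by simp [sMin, hT]
    rw [hs]
    field_simp

/-- The square of the regularized distance of the `i`-th column of `A` from the span of the
others. -/
noncomputable def columnForm {ι : Type*} [Fintype ι] [DecidableEq ι] {r : ℕ} (δ : ℝ)
    (A : Matrix ι (Fin (r + 1)) ℝ) (i : Fin (r + 1)) : ℝ :=
  A.col i ⬝ᵥ ridge δ (A.submatrix id i.succAbove) *ᵥ A.col i

/-- `A v` is `v i` times column `i` plus a combination of the other columns, an admissible
competitor in the variational bound for `ridge`. -/
theorem sq_mul_columnForm_le {ι : Type*} [Fintype ι] [DecidableEq ι] {r : ℕ} {δ : ℝ} (hδ : 0 < δ)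
    (A : Matrix ι (Fin (r + 1)) ℝ) (i : Fin (r + 1)) (v : Fin (r + 1) → ℝ) :
    v i ^ 2 * columnForm δ A i ≤ (A *ᵥ v) ⬝ᵥ (A *ᵥ v) + δ * (v ⬝ᵥ v) := by
  have h := sq_mul_dotProduct_ridge_mulVec_le hδ (A.submatrix id i.succAbove) (A.col i) (v i)
    (fun k => v (i.succAbove k))
  have h1 : v i • A.col i + A.submatrix id i.succAbove *ᵥ (fun k => v (i.succAbove k)) =
      A *ᵥ v := by
    ext m
    simp [Matrix.mulVec, dotProduct, Fin.sum_univ_succAbove _ i, mul_comm]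
  have h2 : (fun k => v (i.succAbove k)) ⬝ᵥ (fun k => v (i.succAbove k)) ≤ v ⬝ᵥ v := by
    simp only [dotProduct, Fin.sum_univ_succAbove (fun k => v k * v k) i]
    nlinarith [mul_self_nonneg (v i)]
  rw [h1] at h
  unfold columnForm
  nlinarith

theorem one_le_sum_columnForm_rpow_neg {ι : Type*} [Fintype ι] [DecidableEq ι] {r : ℕ}
    {s θ : ℝ} (hs0 : 0 < s) (hs1 : s ≤ 1) (hθ : 0 < θ)
    (A : Matrix ι (Fin (r + 1)) ℝ) (hA : sMin A ≤ θ) :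
    1 ≤ ENNReal.ofReal (2 * θ ^ 2) ^ s *
      ∑ i, ENNReal.ofReal (columnForm (θ ^ 2) A i) ^ (-s) := by
  obtain ⟨v, hv1, hv2⟩ := exists_unit_mulVec_sMin A
  have hθ2 : 0 < θ ^ 2 := by positivity
  have hmin : 0 ≤ sMin A := LinearMap.singularValues_nonneg _ _
  have hbound : ∀ i, v i ^ 2 * columnForm (θ ^ 2) A i ≤ 2 * θ ^ 2 := by
    intro i
    have := sq_mul_columnForm_le hθ2 A i v
    rw [hv1, hv2] at this
    nlinarith
  have hle1 : ∀ i, v i ^ 2 ≤ 1 := by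
    intro i
    rw [← hv1, sq]
    exact Finset.single_le_sum (f := fun i => v i * v i) (fun i _ => mul_self_nonneg _)
      (Finset.mem_univ i)
  have hterm : ∀ i, ENNReal.ofReal (v i ^ 2) ≤
      ENNReal.ofReal (2 * θ ^ 2) ^ s * ENNReal.ofReal (columnForm (θ ^ 2) A i) ^ (-s) := by
    intro i
    rcases le_or_gt (columnForm (θ ^ 2) A i) 0 with h | h
    · rw [ENNReal.ofReal_of_nonpos h, ENNReal.zero_rpow_of_neg (by linarith), ENNReal.mul_top]
      · exact le_top
      · exact (ENNReal.rpow_pos (by simpa using hθ2) ENNReal.ofReal_ne_top).ne'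
    · rw [ENNReal.ofReal_rpow_of_pos (by positivity), ENNReal.ofReal_rpow_of_pos h,
        ← ENNReal.ofReal_mul (by positivity)]
      refine ENNReal.ofReal_le_ofReal ?_
      -- Uses `v i ^ 2 ≤ 1` and `s ≤ 1`.
      calc v i ^ 2 ≤ (v i ^ 2) ^ s := by
            rcases (sq_nonneg (v i)).eq_or_lt with h0 | h0
            · rw [← h0, Real.zero_rpow hs0.ne']
            · simpa using Real.rpow_le_rpow_of_exponent_ge h0 (hle1 i) hs1
        _ ≤ (2 * θ ^ 2 / columnForm (θ ^ 2) A i) ^ s := by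
            gcongr
            rw [le_div_iff₀ h]
            exact hbound i
        _ = _ := by
            rw [Real.div_rpow (by positivity) h.le, Real.rpow_neg h.le, div_eq_mul_inv]
  calc (1 : ℝ≥0∞) = ∑ i, ENNReal.ofReal (v i ^ 2) := by
        rw [← ENNReal.ofReal_sum_of_nonneg fun i _ => sq_nonneg _, ← ENNReal.ofReal_one, ← hv1]
        simp only [dotProduct, sq]
    _ ≤ _ := by
        rw [Finset.mul_sum]
        exact Finset.sum_le_sum fun i _ => hterm i

theorem continuous_columnForm {ι : Type*} [Fintype ι] [DecidableEq ι] {r : ℕ} {δ : ℝ} (hδ : 0 < δ)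
    (i : Fin (r + 1)) : Continuous fun A : Matrix ι (Fin (r + 1)) ℝ => columnForm δ A i := by
  unfold columnForm
  have hcol : Continuous fun A : Matrix ι (Fin (r + 1)) ℝ => A.col i :=
    continuous_pi fun m => (continuous_id.matrix_elem m i)
  have hsub : Continuous fun A : Matrix ι (Fin (r + 1)) ℝ => A.submatrix id i.succAbove :=
    continuous_id.matrix_submatrix _ _
  exact hcol.dotProduct (((continuous_ridge hδ).comp hsub).matrix_mulVec hcol)

theorem continuous_tensorMatrix {n ℓ r : ℕ} :
    Continuous (tensorMatrix (n := n) (ℓ := ℓ) (r := r)) := by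
  unfold tensorMatrix
  refine continuous_matrix fun m i => ?_
  simp only [Matrix.of_apply]
  fun_prop

/-! ### Moments of the column forms and the tail bound -/

theorem lintegral_tensor_posSemidef_rpow_neg_le {n ℓ : ℕ} {s : ℝ} (hs : 0 < s) {D : ℝ≥0∞}
    (μ : Fin ℓ → Measure (EuclideanSpace ℝ (Fin n))) [∀ j, IsProbabilityMeasure (μ j)]
    (hμ : ∀ j, NegMomentBound s D (μ j)) {Q : Matrix (Fin ℓ → Fin n) (Fin ℓ → Fin n) ℝ}
    (hQ : Q.PosSemidef) :
    ∫⁻ y, ENNReal.ofReal ((fun m => ∏ j, y j (m j)) ⬝ᵥ Q *ᵥ fun m => ∏ j, y j (m j)) ^ (-s)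
      ∂(Measure.pi μ) ≤ D ^ ℓ * ENNReal.ofReal Q.trace ^ (-s) := by
  -- A rank-one decomposition turns the form into a sum of squares of multilinear forms, with total
  -- squared coefficients equal to the trace.
  obtain ⟨κ, w, rfl⟩ := Matrix.posSemidef_iff_eq_sum_vecMulVec.1 hQ
  have htr : (∑ k, Matrix.vecMulVec (w k) (star (w k))).trace = ∑ k, ∑ m, w k m ^ 2 := by
    rw [Matrix.trace_sum]
    refine Finset.sum_congr rfl fun k _ => ?_
    simp [Matrix.trace, Matrix.vecMulVec_apply, sq]
  have hform : ∀ a : (Fin ℓ → Fin n) → ℝ,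
      a ⬝ᵥ (∑ k, Matrix.vecMulVec (w k) (star (w k))) *ᵥ a = ∑ k, (∑ m, w k m * a m) ^ 2 := by
    intro a
    rw [Matrix.sum_mulVec, dotProduct_sum]
    refine Finset.sum_congr rfl fun k _ => ?_
    rw [Matrix.vecMulVec_mulVec, star_trivial, dotProduct_smul, dotProduct_comm a (w k), sq]
    rfl
  rw [htr]
  simp_rw [hform]
  exact lintegral_pi_tensor_rpow_neg_le hs μ hμ w

/-- Column `i` is independent of the others, so it is integrated first, with the matrix `ridge` of
the other `r` columns held fixed. -/
theorem lintegral_columnForm_rpow_neg_le {n ℓ r : ℕ} {s δ : ℝ} (hs : 0 < s) (hδ : 0 < δ)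
    {D : ℝ≥0∞} (ν : Fin (r + 1) → Fin ℓ → Measure (EuclideanSpace ℝ (Fin n)))
    [∀ i j, IsProbabilityMeasure (ν i j)] (hν : ∀ i j, NegMomentBound s D (ν i j))
    (i : Fin (r + 1)) :
    ∫⁻ y, ENNReal.ofReal (columnForm δ (tensorMatrix y) i) ^ (-s)
      ∂(Measure.pi fun i => Measure.pi (ν i)) ≤
        D ^ ℓ * ENNReal.ofReal ((n : ℝ) ^ ℓ - r) ^ (-s) := by
  have hmp := measurePreserving_piFinSuccAbove (fun i => Measure.pi (ν i)) i
  set F : (Fin ℓ → EuclideanSpace ℝ (Fin n)) × (Fin r → Fin ℓ → EuclideanSpace ℝ (Fin n)) → ℝ≥0∞ :=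
    fun z => ENNReal.ofReal ((fun m => ∏ j, z.1 j (m j)) ⬝ᵥ
      ridge δ (tensorMatrix z.2) *ᵥ fun m => ∏ j, z.1 j (m j)) ^ (-s) with hF
  have hFm : Measurable F := by
    have h1 : Continuous fun z : (Fin ℓ → EuclideanSpace ℝ (Fin n)) ×
        (Fin r → Fin ℓ → EuclideanSpace ℝ (Fin n)) =>
        fun m : Fin ℓ → Fin n => ∏ j, z.1 j (m j) := by fun_prop
    have h2 := ((continuous_ridge hδ).comp
      (continuous_tensorMatrix (n := n) (ℓ := ℓ) (r := r))).comp
      (continuous_snd (X := Fin ℓ → EuclideanSpace ℝ (Fin n)))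
    have h3 := (h1.dotProduct (h2.matrix_mulVec h1)).measurable
    exact h3.ennreal_ofReal.pow_const _
  have heq : ∀ y : Fin (r + 1) → Fin ℓ → EuclideanSpace ℝ (Fin n),
      ENNReal.ofReal (columnForm δ (tensorMatrix y) i) ^ (-s) =
        F (MeasurableEquiv.piFinSuccAbove (fun _ => Fin ℓ → EuclideanSpace ℝ (Fin n)) i y) :=
    fun _ => rfl
  simp_rw [heq]
  rw [hmp.lintegral_comp hFm, lintegral_prod_symm _ hFm.aemeasurable]
  calc _ ≤ ∫⁻ _z, D ^ ℓ * ENNReal.ofReal ((n : ℝ) ^ ℓ - r) ^ (-s)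
          ∂(Measure.pi fun k => Measure.pi (ν (i.succAbove k))) := by
        refine lintegral_mono fun z => ?_
        refine (lintegral_tensor_posSemidef_rpow_neg_le hs (ν i) (hν i)
          (posSemidef_ridge hδ (tensorMatrix z))).trans ?_
        have := le_trace_ridge hδ (tensorMatrix z)
        simp only [Fintype.card_pi, Fintype.card_fin, Finset.prod_const, Finset.card_univ,
          Nat.cast_pow] at this
        simp only [ENNReal.rpow_neg]
        gcongr
    _ = _ := by rw [lintegral_const, measure_univ, mul_one]

/-- Negative-moment tail bound for the smallest singular value. -/
theorem measure_sMin_le {n ℓ r : ℕ} {s θ : ℝ} (hs : 0 < s) (hs1 : s ≤ 1) (hθ : 0 < θ)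
    {D : ℝ≥0∞} (ν : Fin (r + 1) → Fin ℓ → Measure (EuclideanSpace ℝ (Fin n)))
    [∀ i j, IsProbabilityMeasure (ν i j)] (hν : ∀ i j, NegMomentBound s D (ν i j))
    {Ω : Type*} [MeasurableSpace Ω] {P : Measure Ω}
    {Y : Ω → Fin (r + 1) → Fin ℓ → EuclideanSpace ℝ (Fin n)}
    (hY : HasLaw Y (Measure.pi fun i => Measure.pi (ν i)) P) :
    P {ω | sMin (tensorMatrix (Y ω)) ≤ θ} ≤ ENNReal.ofReal (2 * θ ^ 2) ^ s *
      ((r + 1 : ℕ) * (D ^ ℓ * ENNReal.ofReal ((n : ℝ) ^ ℓ - r) ^ (-s))) := by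
  have hθ2 : 0 < θ ^ 2 := by positivity
  set f : Fin (r + 1) → (Fin (r + 1) → Fin ℓ → EuclideanSpace ℝ (Fin n)) → ℝ≥0∞ := fun i y =>
    ENNReal.ofReal (columnForm (θ ^ 2) (tensorMatrix y) i) ^ (-s) with hf
  have hfm : ∀ i, Measurable (f i) := fun i =>
    ((continuous_columnForm hθ2 i).comp
      continuous_tensorMatrix).measurable.ennreal_ofReal.pow_const _
  set g := fun y => ENNReal.ofReal (2 * θ ^ 2) ^ s * ∑ i, f i y with hg
  have hgm : Measurable g := (Finset.measurable_fun_sum _ fun i _ => hfm i).const_mul _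
  calc _ ≤ P {ω | 1 ≤ g (Y ω)} :=
        measure_mono fun ω hω => one_le_sum_columnForm_rpow_neg hs hs1 hθ _ hω
    _ ≤ ∫⁻ ω, g (Y ω) ∂P := by
        simpa using mul_meas_ge_le_lintegral₀ (hgm.comp_aemeasurable hY.aemeasurable) 1
    _ = ∫⁻ y, g y ∂(Measure.pi fun i => Measure.pi (ν i)) := hY.lintegral_comp hgm.aemeasurable
    _ = ENNReal.ofReal (2 * θ ^ 2) ^ s *
          ∑ i, ∫⁻ y, f i y ∂(Measure.pi fun i => Measure.pi (ν i)) := by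
        rw [lintegral_const_mul _ (Finset.measurable_fun_sum _ fun i _ => hfm i),
          lintegral_finsetSum _ fun i _ => hfm i]
    _ ≤ ENNReal.ofReal (2 * θ ^ 2) ^ s *
          ∑ _i : Fin (r + 1), D ^ ℓ * ENNReal.ofReal ((n : ℝ) ^ ℓ - r) ^ (-s) := by
        gcongr with i
        exact lintegral_columnForm_rpow_neg_le hs hθ2 ν hν i
    _ = _ := by
        rw [Finset.sum_const, Finset.card_univ, Fintype.card_fin, nsmul_eq_mul]

/-! ### Joint law, choice of the exponent, conclusion -/

/-- The joint law of a doubly indexed independent family is the iterated product. -/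
theorem ProbabilityTheory.iIndepFun.hasLaw_pi_pi {ι κ Ω E : Type*} [Fintype ι] [Fintype κ]
    [MeasurableSpace Ω] [MeasurableSpace E] {P : Measure Ω} {Y : ι → κ → Ω → E}
    (ν : ι → κ → Measure E) [∀ i j, IsProbabilityMeasure (ν i j)]
    (hY : ∀ i j, HasLaw (Y i j) (ν i j) P) (h : iIndepFun (fun p : ι × κ => Y p.1 p.2) P) :
    HasLaw (fun ω i j => Y i j ω) (Measure.pi fun i => Measure.pi (ν i)) P := by
  have h1 : HasLaw (fun ω (p : ι × κ) => Y p.1 p.2 ω)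
      (Measure.pi fun p : ι × κ => ν p.1 p.2) P := h.hasLaw_pi fun p => hY p.1 p.2
  have h2 : HasLaw (MeasurableEquiv.curry ι κ E) (Measure.pi fun i => Measure.pi (ν i))
      (Measure.pi fun p : ι × κ => ν p.1 p.2) := by
    refine ⟨(MeasurableEquiv.measurable _).aemeasurable, ?_⟩
    have := Measure.infinitePi_map_curry ν
    simpa only [Measure.infinitePi_eq_pi] using this
  exact h2.comp h1

/-- The powers of `ρ`, `n` and the codimension cancel, leaving `2^s ε e^ℓ (r + 1) (2 log (1/ε) /
ℓ)^ℓ`; then `(ℓ - 1)! ≤ ℓ^ℓ`. -/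
theorem negMoment_tail_bound {n ℓ r : ℕ} (hn : 0 < n) (hℓ : 1 ≤ ℓ) {ρ ε : ℝ} (hρ : 0 < ρ)
    (hε : 0 < ε) (hL : (ℓ : ℝ) < Real.log (1 / ε)) (hr : ((r + 1 : ℕ) : ℝ) < (n : ℝ) ^ ℓ)
    {s : ℝ} (hs : s = (1 - ℓ / Real.log (1 / ε)) / 2) :
    ENNReal.ofReal (2 * (√(1 - (r + 1 : ℕ) / (n : ℝ) ^ ℓ) * (1 * ρ) ^ ℓ * ε) ^ 2) ^ s *
      ((r + 1 : ℕ) * ((ENNReal.ofReal (2 / (1 - 2 * s)) *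
        ENNReal.ofReal (ρ ^ 2 / n) ^ (-s)) ^ ℓ * ENNReal.ofReal ((n : ℝ) ^ ℓ - r) ^ (-s))) ≤
    ENNReal.ofReal (ε * (r + 1 : ℕ) / ((ℓ - 1).factorial : ℝ) *
      (4 * Real.exp 1 * Real.log (1 / ε)) ^ ℓ) := by
  set L := Real.log (1 / ε) with hLdef
  have hℓ0 : (0 : ℝ) < ℓ := by exact_mod_cast hℓ
  have hL0 : 0 < L := hℓ0.trans hL
  have hn0 : (0 : ℝ) < n := by exact_mod_cast hn
  have hs2 : 1 - 2 * s = ℓ / L := by rw [hs]; ring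
  have hs0 : 0 < s := by
    have : (ℓ : ℝ) / L < 1 := (div_lt_one hL0).2 hL
    linarith
  have hs1 : s ≤ 1 := by
    have : (0 : ℝ) < ℓ / L := by positivity
    linarith
  set N : ℝ := (n : ℝ) ^ ℓ with hN
  have hN0 : 0 < N := by positivity
  set R : ℝ := ((r + 1 : ℕ) : ℝ) with hR
  have hR0 : 0 ≤ R := Nat.cast_nonneg _
  have hNR : 0 < N - R := by linarith
  have hRr : N - R ≤ N - r := by
    rw [hR]; push_cast; linarith
  have hfrac : 0 < 1 - R / N := by
    rw [sub_pos, div_lt_one hN0]; exact hr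
  -- The codimension is lowered by one, from `N - r` to `N - R`, to match the factor `√(1 - R / N)`
  -- in `θ`.
  have hmono : ENNReal.ofReal (N - r) ^ (-s) ≤ ENNReal.ofReal (N - R) ^ (-s) := by
    simp only [ENNReal.rpow_neg]
    gcongr
  set θ := √(1 - R / N) * (1 * ρ) ^ ℓ * ε with hθ
  have hθ0 : 0 < θ := by
    have := Real.sqrt_pos.2 hfrac
    positivity
  set b := ρ ^ 2 / (n : ℝ) with hb
  have hb0 : 0 < b := by positivity
  have hcast : ((r + 1 : ℕ) : ℝ≥0∞) = ENNReal.ofReal R := (ENNReal.ofReal_natCast _).symm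
  have hpos : 0 < 1 - 2 * s := by rw [hs2]; positivity
  refine (mul_le_mul_right (mul_le_mul_right (mul_le_mul_right hmono _) _) _).trans ?_
  rw [hcast, ENNReal.ofReal_rpow_of_pos (by positivity), ENNReal.ofReal_rpow_of_pos hb0,
    ENNReal.ofReal_rpow_of_pos hNR, ← ENNReal.ofReal_mul (by positivity),
    ← ENNReal.ofReal_pow (by positivity), ← ENNReal.ofReal_mul (by positivity),
    ← ENNReal.ofReal_mul (by positivity), ← ENNReal.ofReal_mul (by positivity)]
  refine ENNReal.ofReal_le_ofReal ?_
  have hθsq : 2 * θ ^ 2 = 2 * ε ^ 2 * (b ^ ℓ * (N - R)) := by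
    rw [hθ, mul_pow, mul_pow, Real.sq_sqrt hfrac.le, hb, div_pow, ← hN, one_mul, ← pow_mul,
      ← pow_mul, mul_comm ℓ 2]
    field_simp
  -- Since `log ε = -L`, the excess factor `ε ^ (-ℓ / L)` equals `e^ℓ`.
  have hε2 : (ε ^ 2) ^ s = ε * Real.exp 1 ^ ℓ := by
    have hlog : Real.log ε = -L := by rw [hLdef, one_div, Real.log_inv, neg_neg]
    rw [← Real.rpow_natCast ε 2, ← Real.rpow_mul hε.le, Real.rpow_def_of_pos hε, hlog,
      ← Real.exp_nat_mul, mul_one]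
    have hexp : ε = Real.exp (-L) := by rw [← hlog, Real.exp_log hε]
    refine Eq.trans ?_ (congrArg (· * Real.exp ℓ) hexp.symm)
    simp only [← Real.exp_add]
    congr 1
    push_cast
    have h2s : 2 * s = 1 - ℓ / L := by linarith
    rw [h2s]
    field_simp
    ring
  have hcancel : (2 * θ ^ 2) ^ s * ((b ^ (-s)) ^ ℓ * (N - R) ^ (-s)) =
      2 ^ s * (ε * Real.exp 1 ^ ℓ) := by
    have h1 : (b ^ (-s)) ^ ℓ = ((b ^ ℓ) ^ s)⁻¹ := by
      rw [← Real.rpow_natCast (b ^ (-s)) ℓ, ← Real.rpow_mul hb0.le, ← Real.rpow_natCast b ℓ,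
        ← Real.rpow_mul hb0.le, ← Real.rpow_neg hb0.le]
      congr 1
      ring
    have hbp : 0 < (b ^ ℓ) ^ s := by positivity
    have hNp : 0 < (N - R) ^ s := Real.rpow_pos_of_pos hNR s
    rw [hθsq, h1, Real.rpow_neg hNR.le, Real.mul_rpow (by positivity) (by positivity),
      Real.mul_rpow (by positivity) (by positivity), Real.mul_rpow (by positivity) hNR.le, hε2]
    field_simp
  have hfact : ((ℓ - 1).factorial : ℝ) ≤ (ℓ : ℝ) ^ ℓ := by
    exact_mod_cast (Nat.factorial_le (Nat.sub_le ℓ 1)).trans (Nat.factorial_le_pow ℓ)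
  have hfact0 : (0 : ℝ) < ((ℓ - 1).factorial : ℝ) := by exact_mod_cast Nat.factorial_pos _
  have h2s : (2 : ℝ) ^ s ≤ 2 ^ ℓ := by
    rw [← Real.rpow_natCast]
    exact Real.rpow_le_rpow_of_exponent_le one_le_two (hs1.trans (by exact_mod_cast hℓ))
  calc _ = (2 * θ ^ 2) ^ s * ((b ^ (-s)) ^ ℓ * (N - R) ^ (-s)) *
          (R * (2 / (1 - 2 * s)) ^ ℓ) := by rw [mul_pow]; ring
    _ = 2 ^ s * ((ε * R * (2 * Real.exp 1 * L) ^ ℓ) / (ℓ : ℝ) ^ ℓ) := by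
        rw [hcancel, hs2, mul_pow, mul_pow, div_pow, div_pow]
        field_simp
    _ ≤ 2 ^ ℓ * ((ε * R * (2 * Real.exp 1 * L) ^ ℓ) / ((ℓ - 1).factorial : ℝ)) := by
        gcongr
    _ = _ := by
        rw [show 4 * Real.exp 1 * L = 2 * (2 * Real.exp 1 * L) by ring,
          mul_pow 2 (2 * Real.exp 1 * L)]
        ring

theorem theorem6p2 :
    ∃ C c C' : ℝ, 0 < C ∧ 0 < c ∧ 0 < C' ∧
      ∀ (n ℓ r : ℕ) (_ : 1 ≤ ℓ) (_ : 1 ≤ r) (_ : (r : ℝ) ≤ (n : ℝ) ^ ℓ / 2)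
        (ρ K : ℝ) (_ : 0 < ρ)
        (X : Fin r → Fin ℓ → EuclideanSpace ℝ (Fin n)) (_ : ∀ i j, ‖X i j‖ ≤ K)
        (Ω : Type*) [MeasurableSpace Ω] (P : Measure Ω) [IsProbabilityMeasure P]
        (G : Fin r → Fin ℓ → Ω → EuclideanSpace ℝ (Fin n))
        (_ : ∀ i j, HasLaw (G i j)
          (multivariateGaussian 0 ((ρ ^ 2 / n) • (1 : Matrix (Fin n) (Fin n) ℝ))) P)
        (_ : iIndepFun (fun p : Fin r × Fin ℓ => G p.1 p.2) P)
        (ε : ℝ) (_ : 0 < ε) (_ : ε < Real.exp (-C * ℓ)),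
        P.real {ω | sMin (tensorMatrix fun i j => X i j + G i j ω) ≤
            √(1 - r / (n : ℝ) ^ ℓ) * (c * ρ) ^ ℓ * ε} ≤
          ε * r / ((ℓ - 1).factorial : ℝ) * (C' * Real.log (1 / ε)) ^ ℓ := by
  -- `C = 1` says `ℓ < log (1/ε)`, that is `s > 0`. In `4e`, one 2 comes from `2 / (1 - 2s)`, the
  -- other from `2^s ≤ 2^ℓ`, and `e` from `ε^(2s)`.
  refine ⟨1, 1, 4 * Real.exp 1, one_pos, one_pos, by positivity, ?_⟩
  intro n ℓ r hℓ hr hrn ρ K hρ X _ Ω _ P _ G hG hind ε hε hεC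
  obtain ⟨r, rfl⟩ : ∃ k, r = k + 1 := ⟨r - 1, by omega⟩
  have hR0 : (0 : ℝ) < ((r + 1 : ℕ) : ℝ) := by positivity
  have hlt : ((r + 1 : ℕ) : ℝ) < (n : ℝ) ^ ℓ := by linarith
  have hn : 0 < n := by
    rcases Nat.eq_zero_or_pos n with rfl | h
    · rw [Nat.cast_zero, zero_pow (by omega)] at hlt
      linarith
    · exact h
  have hn0 : (0 : ℝ) < n := by exact_mod_cast hn
  have hℓ0 : (0 : ℝ) < ℓ := by exact_mod_cast hℓ
  have hL : (ℓ : ℝ) < Real.log (1 / ε) := by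
    rw [one_div, Real.log_inv, lt_neg, Real.log_lt_iff_lt_exp hε]
    simpa using hεC
  have hL0 : 0 < Real.log (1 / ε) := hℓ0.trans hL
  set s := (1 - ℓ / Real.log (1 / ε)) / 2 with hs
  have hq1 : ℓ / Real.log (1 / ε) < 1 := (div_lt_one hL0).2 hL
  have hq0 : 0 < ℓ / Real.log (1 / ε) := by positivity
  have hs0 : 0 < s := by linarith
  have hs2 : s < 1 / 2 := by linarith
  have hθ : 0 < √(1 - (r + 1 : ℕ) / (n : ℝ) ^ ℓ) * (1 * ρ) ^ ℓ * ε := by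
    have : 0 < 1 - ((r + 1 : ℕ) : ℝ) / (n : ℝ) ^ ℓ := by
      rw [sub_pos, div_lt_one (by positivity)]
      exact hlt
    have := Real.sqrt_pos.2 this
    positivity
  set γ := multivariateGaussian 0 ((ρ ^ 2 / n) • (1 : Matrix (Fin n) (Fin n) ℝ)) with hγ
  set ν : Fin (r + 1) → Fin ℓ → Measure (EuclideanSpace ℝ (Fin n)) := fun i j =>
    γ.map (X i j + ·) with hν
  have hprob : ∀ i j, IsProbabilityMeasure (ν i j) := fun i j =>
    Measure.isProbabilityMeasure_map (by fun_prop)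
  have hlaw : ∀ i j, HasLaw (fun ω => X i j + G i j ω) (ν i j) P := fun i j =>
    HasLaw.fun_comp (X := G i j) ⟨by fun_prop, rfl⟩ (hG i j)
  have hind' : iIndepFun (fun (p : Fin (r + 1) × Fin ℓ) ω => X p.1 p.2 + G p.1 p.2 ω) P :=
    hind.comp (fun p y => X p.1 p.2 + y) fun p => by fun_prop
  have hY := hind'.hasLaw_pi_pi (Y := fun i j ω => X i j + G i j ω) ν hlaw
  have hmain := (measure_sMin_le hs0 (by linarith) hθ ν
    (fun i j => negMomentBound_multivariateGaussian hs0 hs2 (by positivity) (X i j)) hY).trans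
    (negMoment_tail_bound hn hℓ hρ hε hL hlt hs)
  exact ENNReal.toReal_le_of_le_ofReal (by positivity) hmain
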